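/- Let $n\ge 1$ and let $(\widetilde M,g)$ be a $(2n+1)$-dimensional smooth Riemannian manifold with Levi-Civita connection $\widetilde\nabla$ and with an almost contact metric structure $(\phi,\xi,\eta)$, that is, $\eta(\xi)=1$, $\phi^2X=-X+\eta(X)\xi$, $\phi\xi=0$, $\eta\circ\phi=0$, $g(\phi X,\phi Y)=g(X,Y)-\eta(X)\eta(Y)$, $\eta(X)=g(X,\xi)$. Suppose that $\widetilde M=\widetilde M(f_1,f_2,f_3)$ is a generalized Sasakian-space-form: for smooth functions $f_1,f_2,f_3$ on $\widetilde M$, the curvature tensor $\widetilde R(X,Y)=\widetilde\nabla_X\widetilde\nabla_Y-\widetilde\nabla_Y\widetilde\nabla_X-\widetilde\nabla_{[X,Y]}$ is $$\begin{aligned}\widetilde R(X,Y)Z={}&f_1\{g(Y,Z)X-g(X,Z)Y\}+f_2\{g(X,\phi Z)\phi Y-g(Y,\phi Z)\phi X+2g(X,\phi Y)\phi Z\}\\&+f_3\{\eta(X)\eta(Z)Y-\eta(Y)\eta(Z)X+g(X,Z)\eta(Y)\xi-g(Y,Z)\eta(X)\xi\}.\end{aligned}$$ Suppose moreover that $\widetilde\nabla_X\xi=-\alpha\,\phi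 X+\beta\,(X-\eta(X)\xi)$ for all tangent vectors $X$ of $\widetilde M$, with some functions $\alpha,\beta$ on $\widetilde M$ (for instance $\widetilde\nabla_X\xi=-(f_1-f_3)\phi X$, i.e. $\alpha=f_1-f_3$, $\beta=0$). Let $M$ be an immersed invariant submanifold of $\widetilde M$: at every point of $M$, $\xi$ is tangent to $M$ and $\phi(TM)\subset TM$. Let $\sigma(X,Y)=(\widetilde\nabla_XY)^\perp$ be its second fundamental form, $\nabla^\perp$ its normal connection and $R^\perp$ the curvature of $\nabla^\perp$. Let $r$ be the scalar curvature of $\widetilde M$ and $$\mathcal C(X,Y)Z=\widetilde R(X,Y)Z-\frac{r}{2n(2n+1)}\{g(Y,Z)X-g(X,Z)Y\}$$ the concircular curvature tensor of $\widetilde M$. For vector fields on $M$ put $$(\mathcal C(X,Y)\cdot\sigma)(U,V)=R^\perp(X,Y)\sigma(U,V)-\sigma(\mathcal C(X,Y)U,V)-\sigma(U,\mathcal C(X,Y)V),$$ $$Q(g,\mathcal C(X,Y)\cdot\sigma)(W,K;U,V)=-(\mathcal C(X,Y)\cdot\sigma)((U\wedge_gV)W,K)-(\mathcal C(X,Y)\cdot\sigma)(W,(U\wedge_gV)K),$$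 where $(U\wedge_gV)Z=g(V,Z)U-g(U,Z)V$; $Q(g,\mathcal C\cdot\sigma)=0$ means that the last expression vanishes for all smooth vector fields $X,Y,W,K,U,V$ on $M$. If $r\neq 2n(2n+1)(f_1-f_3)$ at every point of $M$, then $M$ is totally geodesic ($\sigma=0$) if and only if $Q(g,\mathcal C\cdot\sigma)=0$. -/

import Mathlib

open Bundle Manifold VectorField FiberBundle
open scoped ContDiff

namespace GSSF

noncomputable section

section Ambient

variable {E : Type*} [NormedAddCommGroup E] [NormedSpace ℝ E] [FiniteDimensional ℝ E]
  {H : Type*} [TopologicalSpace H] {I : ModelWithCorners ℝ E H}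
  {N : Type*} [TopologicalSpace N] [ChartedSpace H N] [IsManifold I ∞ N]
  [RiemannianBundle (fun x : N => TangentSpace I x)]

instance (x : N) : FiniteDimensional ℝ (TangentSpace I x) :=
  inferInstanceAs (FiniteDimensional ℝ E)

/-- `cov` is the Levi-Civita connection of the Riemannian metric of `N`: the affine connection
that is torsion-free and compatible with the metric. Here `cov Y x (X x)` is `(∇_X Y)(x)`. -/
structure IsLeviCivita
    (cov : CovariantDerivative I E (fun x : N => TangentSpace I x)) : Prop where
  torsion_free : cov.torsion = 0
  metric : ∀ (X Y Z : Π x : N, TangentSpace I x) (x : N),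
    MDiffAt (T% Y) x → MDiffAt (T% Z) x →
      mvfderiv I (fun y => (inner ℝ (Y y) (Z y) : ℝ)) x (X x) =
        inner ℝ (cov Y x (X x)) (Z x) + inner ℝ (Y x) (cov Z x (X x))

/-- An almost contact metric structure `(φ, ξ, η)` on the Riemannian manifold `N`. -/
structure AlmostContactMetric (I : ModelWithCorners ℝ E H) (N : Type*) [TopologicalSpace N]
    [ChartedSpace H N] [IsManifold I ∞ N]
    [RiemannianBundle (fun x : N => TangentSpace I x)] where
  φ : Π x : N, TangentSpace I x →L[ℝ] TangentSpace I x
  ξ : Π x : N, TangentSpace I x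
  η : Π x : N, TangentSpace I x →L[ℝ] ℝ
  smooth_φ : ContMDiff I (I.prod 𝓘(ℝ, E →L[ℝ] E)) ∞
    (fun x => TotalSpace.mk' (E →L[ℝ] E)
      (E := fun x : N => TangentSpace I x →L[ℝ] TangentSpace I x) x (φ x))
  smooth_ξ : CMDiff ∞ (T% ξ)
  η_ξ : ∀ x, η x (ξ x) = 1
  φ_φ : ∀ x (u : TangentSpace I x), φ x (φ x u) = -u + η x u • ξ x
  φ_ξ : ∀ x, φ x (ξ x) = 0
  η_φ : ∀ x (u : TangentSpace I x), η x (φ x u) = 0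
  inner_φ : ∀ x (u v : TangentSpace I x),
    inner ℝ (φ x u) (φ x v) = inner ℝ u v - η x u * η x v
  η_eq : ∀ x (u : TangentSpace I x), η x u = inner ℝ u (ξ x)

/-- The curvature `R(X, Y)Z = ∇_X ∇_Y Z - ∇_Y ∇_X Z - ∇_[X, Y] Z` on vector fields. -/
def curvature (cov : CovariantDerivative I E (fun x : N => TangentSpace I x))
    (X Y Z : Π x : N, TangentSpace I x) (x : N) : TangentSpace I x :=
  cov (fun y => cov Z y (Y y)) x (X x) - cov (fun y => cov Z y (X y)) x (Y x)
    - cov Z x (mlieBracket I X Y x)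

/-- The curvature tensor `R_x(u, v)w` on tangent vectors at `x`; `extend E u` is a vector field
that is smooth near `x` with value `u` at `x`, and the value is independent of that choice. -/
def Rm (cov : CovariantDerivative I E (fun x : N => TangentSpace I x)) (x : N)
    (u v w : TangentSpace I x) : TangentSpace I x :=
  curvature cov (extend E u) (extend E v) (extend E w) x

/-- The Ricci tensor `S(v, w) = ∑ g(R(e_i, v)w, e_i)`, for an orthonormal basis `e_i`. -/
def ricci (cov : CovariantDerivative I E (fun x : N => TangentSpace I x)) (x : N)
    (v w : TangentSpace I x) : ℝ :=
  ∑ i, inner ℝ (Rm cov x (stdOrthonormalBasis ℝ (TangentSpace I x) i) v w)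
    (stdOrthonormalBasis ℝ (TangentSpace I x) i)

/-- The scalar curvature `r = ∑ S(e_j, e_j)`. -/
def scalarCurvature (cov : CovariantDerivative I E (fun x : N => TangentSpace I x)) (x : N) : ℝ :=
  ∑ j, ricci cov x (stdOrthonormalBasis ℝ (TangentSpace I x) j)
    (stdOrthonormalBasis ℝ (TangentSpace I x) j)

/-- `N(f₁, f₂, f₃)` is a generalized Sasakian-space-form: smooth functions `f₁, f₂, f₃` express the
curvature tensor of the Levi-Civita connection `cov` through the almost contact metric structure. -/
structure IsGeneralizedSasakianSpaceForm
    (cov : CovariantDerivative I E (fun x : N => TangentSpace I x))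
    (S : AlmostContactMetric I N) (f₁ f₂ f₃ : N → ℝ) : Prop where
  smooth₁ : CMDiff ∞ f₁
  smooth₂ : CMDiff ∞ f₂
  smooth₃ : CMDiff ∞ f₃
  curvature_eq : ∀ (x : N) (X Y Z : TangentSpace I x),
    Rm cov x X Y Z =
      f₁ x • ((inner ℝ Y Z : ℝ) • X - (inner ℝ X Z : ℝ) • Y)
      + f₂ x • ((inner ℝ X (S.φ x Z) : ℝ) • S.φ x Y - (inner ℝ Y (S.φ x Z) : ℝ) • S.φ x X
          + (2 * inner ℝ X (S.φ x Y) : ℝ) • S.φ x Z)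
      + f₃ x • ((S.η x X * S.η x Z) • Y - (S.η x Y * S.η x Z) • X
          + (inner ℝ X Z * S.η x Y : ℝ) • S.ξ x - (inner ℝ Y Z * S.η x X : ℝ) • S.ξ x)

/-- The concircular curvature tensor
`𝒞(u, v)w = R(u, v)w - r / (2n(2n+1)) (g(v, w)u - g(u, w)v)` of a `(2n+1)`-manifold. -/
def concircular (n : ℕ) (cov : CovariantDerivative I E (fun x : N => TangentSpace I x)) (x : N)
    (u v w : TangentSpace I x) : TangentSpace I x :=
  Rm cov x u v w - (scalarCurvature cov x / (2 * n * (2 * n + 1))) •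
    ((inner ℝ v w : ℝ) • u - (inner ℝ u w : ℝ) • v)

end Ambient

section Submanifold

variable {E : Type*} [NormedAddCommGroup E] [NormedSpace ℝ E] [FiniteDimensional ℝ E]
  {H : Type*} [TopologicalSpace H] {I : ModelWithCorners ℝ E H}
  {N : Type*} [TopologicalSpace N] [ChartedSpace H N] [IsManifold I ∞ N]
  [RiemannianBundle (fun x : N => TangentSpace I x)]
  {E' : Type*} [NormedAddCommGroup E'] [NormedSpace ℝ E'] [FiniteDimensional ℝ E']
  {H' : Type*} [TopologicalSpace H'] {J : ModelWithCorners ℝ E' H'}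
  {M : Type*} [TopologicalSpace M] [ChartedSpace H' M] [IsManifold J ∞ M]

/-- The tangent space of the submanifold `f : M → N` at `p`, as a subspace of `T_{f p} N`. -/
def tangent (I : ModelWithCorners ℝ E H) (J : ModelWithCorners ℝ E' H') (f : M → N) (p : M) :
    Submodule ℝ (TangentSpace I (f p)) :=
  LinearMap.range (mfderiv J I f p).toLinearMap

/-- The component of `w ∈ T_{f p} N` normal to the submanifold. -/
def normalPart (J : ModelWithCorners ℝ E' H') (f : M → N) (p : M)
    (w : TangentSpace I (f p)) : TangentSpace I (f p) :=
  w - (tangent I J f p).starProjection w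

/-- The tangential component of `w ∈ T_{f p} N`, as a vector of `T_p M`. -/
def tangentPart (J : ModelWithCorners ℝ E' H') (f : M → N) (p : M)
    (w : TangentSpace I (f p)) : TangentSpace J p :=
  Function.invFun (mfderiv J I f p) ((tangent I J f p).starProjection w)

/-- The covariant derivative of a vector field `V` along `f : M → N` induced by a connection on `N`
(the pullback connection). In the trivialization of `TN` at `f p`, with frame `e_i`, write
`V = ∑ V^i (e_i ∘ f)` near `p`; then `(∇_u V)(p) = ∑ dV^i(u) e_i + ∇_{df u} (∑ V^i(p) e_i)`,
and `extend E (V p)` is the local field `∑ V^i(p) e_i` on `N`. -/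
def covAlong (J : ModelWithCorners ℝ E' H')
    (cov : CovariantDerivative I E (fun x : N => TangentSpace I x)) (f : M → N)
    (V : Π p : M, TangentSpace I (f p)) (p : M) (u : TangentSpace J p) : TangentSpace I (f p) :=
  (trivializationAt E (fun x : N => TangentSpace I x) (f p)).symm (f p)
      (mfderiv J 𝓘(ℝ, E)
        (fun q => (trivializationAt E (fun x : N => TangentSpace I x) (f p) ⟨f q, V q⟩).2) p u)
    + cov (extend E (V p)) (f p) (mfderiv J I f p u)

/-- The second fundamental form `σ(u, v)`: the normal part of `∇_u V` for a vector field `V` on `M`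
with value `v` at `p`. -/
def sff (cov : CovariantDerivative I E (fun x : N => TangentSpace I x)) (f : M → N) (p : M)
    (u v : TangentSpace J p) : TangentSpace I (f p) :=
  normalPart J f p (covAlong J cov f (fun q => mfderiv J I f q (extend E' v q)) p u)

/-- The normal connection `∇^⊥_u V` on normal fields `V`. -/
def normalCov (cov : CovariantDerivative I E (fun x : N => TangentSpace I x)) (f : M → N)
    (V : Π p : M, TangentSpace I (f p)) (p : M) (u : TangentSpace J p) : TangentSpace I (f p) :=
  normalPart J f p (covAlong J cov f V p u)

/-- The curvature `R^⊥(X, Y)V` of the normal connection. -/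
def normalCurvature (cov : CovariantDerivative I E (fun x : N => TangentSpace I x)) (f : M → N)
    (X Y : Π p : M, TangentSpace J p) (V : Π p : M, TangentSpace I (f p)) (p : M) :
    TangentSpace I (f p) :=
  normalCov cov f (fun q => normalCov cov f V q (Y q)) p (X p)
    - normalCov cov f (fun q => normalCov cov f V q (X q)) p (Y p)
    - normalCov cov f V p (mlieBracket J X Y p)

/-- `𝒞(X, Y)U` for vector fields on `M`, as a vector field on `M`. (For an invariant submanifold of
a generalized Sasakian-space-form, `𝒞(X, Y)U` is tangent to `M`, so nothing is lost by taking the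
tangential component.) -/
def concircularTangent (n : ℕ) (cov : CovariantDerivative I E (fun x : N => TangentSpace I x))
    (f : M → N) (X Y U : Π p : M, TangentSpace J p) (p : M) : TangentSpace J p :=
  tangentPart J f p (concircular n cov (f p)
    (mfderiv J I f p (X p)) (mfderiv J I f p (Y p)) (mfderiv J I f p (U p)))

/-- `(𝒞(X, Y)·σ)(U, V) = R^⊥(X, Y)σ(U, V) - σ(𝒞(X, Y)U, V) - σ(U, 𝒞(X, Y)V)`. -/
def concircularDotSff (n : ℕ) (cov : CovariantDerivative I E (fun x : N => TangentSpace I x))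
    (f : M → N) (X Y U V : Π p : M, TangentSpace J p) (p : M) : TangentSpace I (f p) :=
  normalCurvature cov f X Y (fun q => sff cov f q (U q) (V q)) p
    - sff cov f p (concircularTangent n cov f X Y U p) (V p)
    - sff cov f p (U p) (concircularTangent n cov f X Y V p)

/-- The metric of `M` induced by `f : M → N`, on vector fields. -/
def inducedMetric (I : ModelWithCorners ℝ E H) [IsManifold I ∞ N]
    [RiemannianBundle (fun x : N => TangentSpace I x)] (f : M → N)
    (X Y : Π p : M, TangentSpace J p) (p : M) : ℝ :=
  inner ℝ (mfderiv J I f p (X p)) (mfderiv J I f p (Y p))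

/-- `(X ∧_B Y)Z = B(Y, Z)X - B(X, Z)Y`. -/
def wedge (B : (Π p : M, TangentSpace J p) → (Π p : M, TangentSpace J p) → M → ℝ)
    (X Y Z : Π p : M, TangentSpace J p) (p : M) : TangentSpace J p :=
  B Y Z p • X p - B X Z p • Y p

/-- `Q(B, T)(W, K; U, V) = -T((U ∧_B V)W, K) - T(W, (U ∧_B V)K)`, for a bilinear form `B` on the
vector fields of `M` and a form `T` on pairs of them with values in vector fields along `f`. -/
def tachibana (f : M → N) (B : (Π p : M, TangentSpace J p) → (Π p : M, TangentSpace J p) → M → ℝ)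
    (T : (Π p : M, TangentSpace J p) → (Π p : M, TangentSpace J p) →
      (Π p : M, TangentSpace I (f p)))
    (W K U V : Π p : M, TangentSpace J p) (p : M) : TangentSpace I (f p) :=
  -T (wedge B U V W) K p - T W (wedge B U V K) p

/-- `Q(g, 𝒞·σ) = 0`. -/
def QgConcircularSffVanishes (n : ℕ)
    (cov : CovariantDerivative I E (fun x : N => TangentSpace I x)) (J : ModelWithCorners ℝ E' H')
    [IsManifold J ∞ M] (f : M → N) : Prop :=
  ∀ X Y W K U V : Π p : M, TangentSpace J p,
    CMDiff ∞ (T% X) → CMDiff ∞ (T% Y) → CMDiff ∞ (T% W) → CMDiff ∞ (T% K) →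
    CMDiff ∞ (T% U) → CMDiff ∞ (T% V) →
    ∀ p, tachibana f (inducedMetric I f) (concircularDotSff n cov f X Y) W K U V p = 0

/-- The second fundamental form vanishes identically. -/
def IsTotallyGeodesic (cov : CovariantDerivative I E (fun x : N => TangentSpace I x))
    (J : ModelWithCorners ℝ E' H') [IsManifold J ∞ M] (f : M → N) : Prop :=
  ∀ (p : M) (u v : TangentSpace J p), sff cov f p u v = 0

/-- The submanifold `f : M → N` is invariant: `ξ` is tangent to it and `φ(TM) ⊆ TM`. -/
structure IsInvariant (S : AlmostContactMetric I N) (J : ModelWithCorners ℝ E' H')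
    (f : M → N) : Prop where
  ξ_mem : ∀ p, S.ξ (f p) ∈ tangent I J f p
  φ_mem : ∀ p, ∀ w ∈ tangent I J f p, S.φ (f p) w ∈ tangent I J f p

end Submanifold

end

end GSSF

open Filter
open scoped Topology

set_option linter.unusedSectionVars false

/-! Write `c = f₁ - f₃ - r / (2n(2n+1))`. Invariance makes `∇_u ξ` tangent to `M`, so `σ(·, ξ) = 0`;
the curvature formula gives `𝒞(X, ξ)ξ = c (X - η(X)ξ)`. In `(𝒞(X, ξ)·σ)(U, ξ)` the field `σ(U, ξ)`
is identically zero, so the `R^⊥` term drops, and so does `σ(𝒞(X, ξ)U, ξ)`; what remains is `-c σ(X,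
U)`. Since `(U ∧ ξ)ξ = U - η(U)ξ`, evaluating `Q(g, 𝒞(X, ξ)·σ)` at `(ξ, ξ; U, ξ)` gives `2c σ(X,
U)`. As `c` vanishes nowhere on `M`, `Q = 0` forces `σ = 0`. Conversely, every term of `𝒞·σ`
vanishes with `σ`.

The geometric core is `IsInvariant.sff_tangentξ` and `IsInvariant.concircularDotSff_tangentξ_right`.
They rest on `σ` being a symmetric bilinear tensor, although it is defined through a particular
local extension of a vector. This is read off from the chart formula `sff_eq`: the normal part of a
second derivative plus a Christoffel term. Finally, `ξ` has to be a smooth vector field on `M` and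
tangent vectors have to extend to global smooth fields, because `Q = 0` tests only such fields. -/

namespace GSSF

noncomputable section
-- Connections in the tangent bundle trivialization: Christoffel terms and their symmetry.
section Ambient

variable {E : Type*} [NormedAddCommGroup E] [NormedSpace ℝ E]
  {H : Type*} [TopologicalSpace H] {I : ModelWithCorners ℝ E H}
  {N : Type*} [TopologicalSpace N] [ChartedSpace H N] [IsManifold I ∞ N]

/-- The reading of a vector field in the tangent bundle trivialization at `x`. -/
abbrev coords (I : ModelWithCorners ℝ E H) [IsManifold I ∞ N] (x : N) (z : TangentBundle I N) : E :=
  (trivializationAt E (fun y : N => TangentSpace I y) x z).2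

/-- The trivialization of the tangent bundle at `x` is the derivative of the preferred chart at `x`;
linearity and all chain rules below come from this. -/
lemma coords_eq_mvfderiv {x y : N} (hy : y ∈ (chartAt H x).source) (w : TangentSpace I y) :
    coords I x ⟨y, w⟩ = mvfderiv I (extChartAt I x) y w := by
  have h := TangentBundle.continuousLinearMapAt_trivializationAt (I := I) hy
  exact (Trivialization.continuousLinearMapAt_apply_of_mem (R := ℝ)
    (trivializationAt E (fun y : N => TangentSpace I y) x) hy w).symm.trans congr($h w)

lemma eventually_mem_chart_source (x : N) : ∀ᶠ y in 𝓝 x, y ∈ (chartAt H x).source :=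
  (chartAt H x).open_source.mem_nhds (mem_chart_source H x)

lemma coords_add {x y : N} (hy : y ∈ (chartAt H x).source) (v w : TangentSpace I y) :
    coords I x ⟨y, v + w⟩ = coords I x ⟨y, v⟩ + coords I x ⟨y, w⟩ := by
  simp only [coords_eq_mvfderiv hy, map_add]

lemma coords_smul {x y : N} (hy : y ∈ (chartAt H x).source) (c : ℝ) (w : TangentSpace I y) :
    coords I x ⟨y, c • w⟩ = c • coords I x ⟨y, w⟩ := by
  simp only [coords_eq_mvfderiv hy, map_smul]

lemma symm_coords {x y : N} (hy : y ∈ (chartAt H x).source) (w : TangentSpace I y) :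
    (trivializationAt E (fun y : N => TangentSpace I y) x).symm y (coords I x ⟨y, w⟩) = w :=
  Trivialization.symm_apply_apply_mk _ hy w

lemma coords_symm {x y : N} (hy : y ∈ (chartAt H x).source) (w : E) :
    coords I x ⟨y, (trivializationAt E (fun y : N => TangentSpace I y) x).symm y w⟩ = w := by
  simp only [coords]
  rw [Trivialization.apply_mk_symm _ (by exact hy)]

lemma coords_extend {x y : N} (hy : y ∈ (chartAt H x).source) (v : TangentSpace I x) :
    coords I x ⟨y, extend E v y⟩ = coords I x ⟨x, v⟩ :=
  coords_symm hy _

lemma symm_eq_symmL {x y : N} (hy : y ∈ (chartAt H x).source) (w : E) :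
    (trivializationAt E (fun y : N => TangentSpace I y) x).symm y w =
      (trivializationAt E (fun y : N => TangentSpace I y) x).symmL ℝ y w :=
  (Trivialization.symmL_apply (R := ℝ)
    (trivializationAt E (fun y : N => TangentSpace I y) x) hy w).symm

/-- The differential of a vector field read in the trivialization at `x`. -/
def flatDeriv (X : Π x : N, TangentSpace I x) (x : N) (u : TangentSpace I x) :
    TangentSpace I x :=
  (trivializationAt E (fun y : N => TangentSpace I y) x).symmL ℝ x
    (mvfderiv I (fun y => coords I x ⟨y, X y⟩) x u)

lemma mvfderiv_congr_of_eventuallyEq {F : Type*} [NormedAddCommGroup F] [NormedSpace ℝ F]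
    {g h : N → F} {x : N} (hgh : g =ᶠ[𝓝 x] h) : mvfderiv I g x = mvfderiv I h x := by
  ext u
  exact congr($(hgh.mfderiv_eq (I := I) (I' := 𝓘(ℝ, F))) u)

lemma mdifferentiableAt_coords {X : Π x : N, TangentSpace I x} {x : N} (hX : MDiffAt (T% X) x) :
    MDiffAt (fun y => coords I x ⟨y, X y⟩) x :=
  (mdifferentiableAt_section I X).1 hX

/-- Both operators obey the Leibniz rule with the same derivative term, which cancels in the
difference. -/
lemma tensorialAt_cov_sub_flatDeriv
    (cov : CovariantDerivative I E (fun x : N => TangentSpace I x)) (x : N)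
    (u : TangentSpace I x) :
    TensorialAt I E (fun X : (Π x : N, TangentSpace I x) => cov X x u - flatDeriv X x u) x where
  smul {g X} hg hX := by
    have hX' := mdifferentiableAt_coords hX
    have h : (fun y => coords I x ⟨y, (g • X) y⟩) =ᶠ[𝓝 x] g • fun y => coords I x ⟨y, X y⟩ := by
      filter_upwards [eventually_mem_chart_source (H := H) x] with y hy
      exact coords_smul hy _ _
    have h2 : mvfderiv I (fun y => coords I x ⟨y, (g • X) y⟩) x u =
      g x • mvfderiv I (fun y => coords I x ⟨y, X y⟩) x u +
        (mvfderiv I g x u) • coords I x ⟨x, X x⟩ := by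
      rw [mvfderiv_congr_of_eventuallyEq h, mvfderiv_smul hg hX']
      rfl
    simp only [flatDeriv, h2, map_add, map_smul]
    rw [← symm_eq_symmL (mem_chart_source H x) (coords I x ⟨x, X x⟩), symm_coords (mem_chart_source H x),
      cov.isCovariantDerivativeOn.leibniz hX hg]
    simp
    module
  add {X Y} hX hY := by
    have hX' := mdifferentiableAt_coords hX
    have hY' := mdifferentiableAt_coords hY
    have h : (fun y => coords I x ⟨y, (X + Y) y⟩) =ᶠ[𝓝 x]
        (fun y => coords I x ⟨y, X y⟩) + fun y => coords I x ⟨y, Y y⟩ := by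
      filter_upwards [eventually_mem_chart_source (H := H) x] with y hy
      exact coords_add hy _ _
    have h2 : mvfderiv I (fun y => coords I x ⟨y, (X + Y) y⟩) x u =
      mvfderiv I (fun y => coords I x ⟨y, X y⟩) x u +
      mvfderiv I (fun y => coords I x ⟨y, Y y⟩) x u := by
      rw [mvfderiv_congr_of_eventuallyEq h, mvfderiv_add hX' hY']
      rfl
    simp only [flatDeriv, h2, map_add]
    rw [cov.isCovariantDerivativeOn.add hX hY]
    simp
    module

lemma flatDeriv_extend {x : N} (u v : TangentSpace I x) : flatDeriv (extend E v) x u = 0 := by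
  have h : (fun y => coords I x ⟨y, extend E v y⟩) =ᶠ[𝓝 x] fun _ => coords I x ⟨x, v⟩ := by
    filter_upwards [eventually_mem_chart_source (H := H) x] with y hy
    exact coords_extend hy v
  simp only [flatDeriv]
  rw [mvfderiv_congr_of_eventuallyEq h, mvfderiv_const]
  simp

/-- A connection is the flat derivative plus Christoffel symbols: by tensoriality the difference
depends only on `X x`, and on the frame-constant field `extend E (X x)` the flat part is zero.
`covAlong` is modelled on this splitting. -/
lemma cov_eq_flatDeriv_add [FiniteDimensional ℝ E]
    (cov : CovariantDerivative I E (fun x : N => TangentSpace I x)) {x : N}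
    {X : Π x : N, TangentSpace I x} (hX : MDiffAt (T% X) x) (u : TangentSpace I x) :
    cov X x u = flatDeriv X x u + cov (extend E (X x)) x u := by
  have h := (tensorialAt_cov_sub_flatDeriv cov x u).pointwise hX
    (mdifferentiableAt_extend (I := I) (F := E) (X x)) (by simp)
  simp only [flatDeriv_extend, sub_zero] at h
  rw [← h]; abel

lemma mlieBracket_extend {x : N} (u v : TangentSpace I x) :
    mlieBracket I (extend E u) (extend E v) x = 0 := by
  -- Since the trivialization is the derivative of the chart, `extend E w` becomes a constant field
  -- in the chart at `x`, and constant fields commute.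
  have key (w : TangentSpace I x) :
      mpullbackWithin 𝓘(ℝ, E) I (extChartAt I x).symm (extend E w) (Set.range I)
        =ᶠ[𝓝[Set.range I] (extChartAt I x x)] fun _ => coords I x ⟨x, w⟩ := by
    filter_upwards [extChartAt_target_mem_nhdsWithin (I := I) x] with y hy
    have hs : (extChartAt I x).symm y ∈ (chartAt H x).source := by
      simpa using (extChartAt I x).map_target hy
    have h1 := TangentBundle.symmL_trivializationAt (I := I) hs
    rw [(extChartAt I x).right_inv hy] at h1
    simp only [mpullbackWithin]
    rw [← h1]
    have h2 : extend E w ((extChartAt I x).symm y) =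
        (trivializationAt E (fun y : N => TangentSpace I y) x).symmL ℝ _ (coords I x ⟨x, w⟩) := symm_eq_symmL hs _
    rw [h2]
    have hinv := isInvertible_mfderivWithin_extChartAt_symm (I := I) hy
    rw [← h1] at hinv
    exact hinv.inverse_apply_eq.2 rfl
  simp only [mlieBracket, mlieBracketWithin, mpullback]
  rw [Set.preimage_univ, Set.univ_inter]
  have hx : extChartAt I x x ∈ Set.range I :=
    extChartAt_target_subset_range x (mem_extChartAt_target x)
  rw [(key u).lieBracketWithin_vectorField_eq_of_mem (key v) hx]
  simp only [lieBracketWithin, fderivWithin_fun_const]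
  erw [sub_self]
  exact map_zero _

variable [RiemannianBundle (fun x : N => TangentSpace I x)]

/-- Symmetry of the Christoffel symbols: the torsion vanishes and frame-constant fields have zero
bracket at `x`. -/
lemma IsLeviCivita.cov_extend_comm [FiniteDimensional ℝ E]
    {cov : CovariantDerivative I E (fun x : N => TangentSpace I x)} (hcov : IsLeviCivita cov)
    {x : N} (u v : TangentSpace I x) :
    cov (extend E v) x u = cov (extend E u) x v := by
  have h := cov.torsion_apply_eq_extend u v
  rw [hcov.torsion_free, mlieBracket_extend] at h
  simp only [extend_apply_self, sub_zero] at h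
  exact sub_eq_zero.1 h.symm

end Ambient

/-! ### Derivatives of vector fields along a map, in charts. -/

section Along

variable {E : Type*} [NormedAddCommGroup E] [NormedSpace ℝ E]
  {H : Type*} [TopologicalSpace H] {I : ModelWithCorners ℝ E H}
  {N : Type*} [TopologicalSpace N] [ChartedSpace H N] [IsManifold I ∞ N]
  {E' : Type*} [NormedAddCommGroup E'] [NormedSpace ℝ E']
  {H' : Type*} [TopologicalSpace H'] {J : ModelWithCorners ℝ E' H'}
  {M : Type*} [TopologicalSpace M] [ChartedSpace H' M] [IsManifold J ∞ M]
  {f : M → N} {p : M}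

lemma mvfderiv_comp_mfderiv_apply {F : Type*} [NormedAddCommGroup F] [NormedSpace ℝ F]
    {g : N → F} (hg : MDiffAt g (f p)) (hf : MDiffAt f p) (u : TangentSpace J p) :
    mvfderiv J (g ∘ f) p u = mvfderiv I g (f p) (mfderiv J I f p u) :=
  mfderiv_comp_apply p hg hf u

section CovAlong

variable [FiniteDimensional ℝ E] (cov : CovariantDerivative I E (fun x : N => TangentSpace I x))

lemma covAlong_eq (V : Π p : M, TangentSpace I (f p)) (u : TangentSpace J p) :
    covAlong J cov f V p u =
      (trivializationAt E (fun y : N => TangentSpace I y) (f p)).symmL ℝ (f p)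
        (mvfderiv J (fun q => coords I (f p) ⟨f q, V q⟩) p u)
      + cov (extend E (V p)) (f p) (mfderiv J I f p u) := by
  rw [← symm_eq_symmL (mem_chart_source H (f p))]
  rfl

/-- The chain rule carries the flat part through `f`; the Christoffel part already agrees. This is
how `∇ξ` on the ambient manifold enters the second fundamental form. -/
lemma covAlong_comp (hf : MDiffAt f p) {X : Π x : N, TangentSpace I x}
    (hX : MDiffAt (T% X) (f p)) (u : TangentSpace J p) :
    covAlong J cov f (fun q => X (f q)) p u = cov X (f p) (mfderiv J I f p u) := by
  have h := mvfderiv_comp_mfderiv_apply (mdifferentiableAt_coords hX) hf u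
  rw [covAlong_eq, cov_eq_flatDeriv_add cov hX, flatDeriv, ← h]
  rfl

lemma covAlong_zero (hf : ContinuousAt f p) (u : TangentSpace J p) :
    covAlong J cov f (fun q => (0 : TangentSpace I (f q))) p u = 0 := by
  have h : (fun q => coords I (f p) ⟨f q, (0 : TangentSpace I (f q))⟩) =ᶠ[𝓝 p] fun _ => 0 := by
    filter_upwards [hf.eventually (eventually_mem_chart_source (H := H) (f p))] with q hq
    rw [coords_eq_mvfderiv hq, map_zero]
  have h0 : cov (extend E (0 : TangentSpace I (f p))) (f p) = 0 := by
    rw [← cov.isCovariantDerivativeOn.zero (x := f p)]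
    refine cov.isCovariantDerivativeOn.congr_of_eventuallyEq (s := Set.univ)
      (mdifferentiableAt_extend ..) (mdifferentiableAt_zeroSection ..) Filter.univ_mem ?_
    filter_upwards [eventually_mem_chart_source (H := H) (f p)] with y hy
    have : coords I (f p) ⟨f p, 0⟩ = 0 :=
      (coords_eq_mvfderiv (mem_chart_source H (f p)) 0).trans (map_zero _)
    change (trivializationAt E (fun x : N => TangentSpace I x) (f p)).symm y
      (coords I (f p) ⟨f p, 0⟩) = 0
    rw [this, symm_eq_symmL hy, map_zero]
  rw [covAlong_eq, mvfderiv_congr_of_eventuallyEq h, mvfderiv_const, h0]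
  simp

end CovAlong

/-- The expression of `f` in the preferred charts at `p` and `f p`. -/
abbrev chartRep (I : ModelWithCorners ℝ E H) (J : ModelWithCorners ℝ E' H') (f : M → N) (p : M) :
    E' → E := extChartAt I (f p) ∘ f ∘ (extChartAt J p).symm

lemma coords_mfderiv [J.Boundaryless] (hf : ContMDiff J I ∞ f) {q : M}
    (hq : q ∈ (chartAt H' p).source) (hfq : f q ∈ (chartAt H (f p)).source)
    (hF : DifferentiableAt ℝ (chartRep I J f p) (extChartAt J p q))
    (v : TangentSpace J q) :
    coords I (f p) ⟨f q, mfderiv J I f q v⟩ =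
      fderiv ℝ (chartRep I J f p) (extChartAt J p q) (coords J p ⟨q, v⟩) := by
  have hφ : MDiffAt (extChartAt J p) q := mdifferentiableAt_extChartAt hq
  have hψ : MDiffAt (extChartAt I (f p)) (f q) := mdifferentiableAt_extChartAt hfq
  have hcomp := mvfderiv_comp_mfderiv_apply hψ ((hf q).mdifferentiableAt (by simp)) v
  rw [coords_eq_mvfderiv hfq, coords_eq_mvfderiv hq, ← hcomp]
  have h : (extChartAt I (f p) ∘ f) =ᶠ[𝓝 q] chartRep I J f p ∘ extChartAt J p := by
    filter_upwards [(chartAt H' p).open_source.mem_nhds hq] with q' hq'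
    have : (extChartAt J p).symm (extChartAt J p q') = q' :=
      (extChartAt J p).left_inv (by simpa using hq')
    simp only [chartRep, Function.comp_apply, this]
  rw [mvfderiv_congr_of_eventuallyEq h]
  have h3 := hF.hasFDerivAt.hasMFDerivAt.comp q hφ.hasMFDerivAt
  exact congr($(h3.mfderiv) v)

lemma contDiffAt_chartRep [J.Boundaryless] (hf : ContMDiff J I ∞ f) :
    ContDiffAt ℝ 2 (chartRep I J f p) (extChartAt J p p) := by
  have h := (contMDiffAt_iff.1 (hf p)).2
  rw [J.range_eq_univ, contDiffWithinAt_univ] at h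
  exact h.of_le ENat.LEInfty.out

/-- Product rule for `q ↦ DF(q) V(q)`, with `F` the chart expression of `f`. The second summand will
turn out to be tangent to `M`, so only the Hessian of `F` contributes to `σ`. -/
lemma mvfderiv_coords_mfderiv [J.Boundaryless] (hf : ContMDiff J I ∞ f)
    {V : Π q : M, TangentSpace J q} (hV : MDiffAt (T% V) p) (u : TangentSpace J p) :
    mvfderiv J (fun q => coords I (f p) ⟨f q, mfderiv J I f q (V q)⟩) p u =
      fderiv ℝ (fderiv ℝ (chartRep I J f p)) (extChartAt J p p)
        (coords J p ⟨p, u⟩) (coords J p ⟨p, V p⟩) +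
      fderiv ℝ (chartRep I J f p) (extChartAt J p p)
        (mvfderiv J (fun q => coords J p ⟨q, V q⟩) p u) := by
  set F := chartRep I J f p
  have hF2 : ContDiffAt ℝ 2 F (extChartAt J p p) := contDiffAt_chartRep hf
  have hφ : MDiffAt (extChartAt J p) p := mdifferentiableAt_extChartAt (mem_chart_source H' p)
  have hFev : ∀ᶠ q in 𝓝 p, DifferentiableAt ℝ F (extChartAt J p q) :=
    hφ.continuousAt.eventually ((hF2.eventually (by simp)).mono
      fun y hy => hy.differentiableAt (by simp))
  have hev : (fun q => coords I (f p) ⟨f q, mfderiv J I f q (V q)⟩) =ᶠ[𝓝 p]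
      fun q => fderiv ℝ F (extChartAt J p q) (coords J p ⟨q, V q⟩) := by
    filter_upwards [hFev, eventually_mem_chart_source (H := H') p,
      (hf p).continuousAt.eventually (eventually_mem_chart_source (H := H) (f p))] with q h1 h2 h3
    exact coords_mfderiv hf h2 h3 h1 _
  have hdF : DifferentiableAt ℝ (fderiv ℝ F) (extChartAt J p p) :=
    (hF2.fderiv_right (m := 1) (by norm_num)).differentiableAt (by simp)
  have hV' := mdifferentiableAt_coords hV
  have hpair : HasMFDerivAt J 𝓘(ℝ, E' × E')
      (fun q => (extChartAt J p q, coords J p ⟨q, V q⟩)) p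
      ((mvfderiv J (extChartAt J p) p).prod (mvfderiv J (fun q => coords J p ⟨q, V q⟩) p)) :=
    ⟨hφ.hasMFDerivAt.1.prodMk hV'.hasMFDerivAt.1, hφ.hasMFDerivAt.2.prodMk hV'.hasMFDerivAt.2⟩
  -- The field is the evaluation map `(z₁, z₂) ↦ DF(z₁) z₂` composed with `q ↦ (chart q, coordinates
  -- of V q)`.
  have hG : HasFDerivAt (fun z : E' × E' => fderiv ℝ F z.1 z.2) _
      (extChartAt J p p, coords J p ⟨p, V p⟩) :=
    HasFDerivAt.clm_apply (hdF.hasFDerivAt.comp (extChartAt J p p, coords J p ⟨p, V p⟩)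
      (hasFDerivAt_fst (𝕜 := ℝ))) (hasFDerivAt_snd (𝕜 := ℝ))
  have htot := hG.hasMFDerivAt.comp p hpair
  rw [mvfderiv_congr_of_eventuallyEq hev, coords_eq_mvfderiv (mem_chart_source H' p) u]
  refine (congr($(htot.mfderiv) u)).trans ?_
  exact add_comm _ _

end Along

/-! ### The second fundamental form as a symmetric bilinear tensor. -/

section SecondFundamentalForm

variable {E : Type*} [NormedAddCommGroup E] [NormedSpace ℝ E] [FiniteDimensional ℝ E]
  {H : Type*} [TopologicalSpace H] {I : ModelWithCorners ℝ E H}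
  {N : Type*} [TopologicalSpace N] [ChartedSpace H N] [IsManifold I ∞ N]
  [RiemannianBundle (fun x : N => TangentSpace I x)]
  {E' : Type*} [NormedAddCommGroup E'] [NormedSpace ℝ E']
  {H' : Type*} [TopologicalSpace H'] {J : ModelWithCorners ℝ E' H'}
  {M : Type*} [TopologicalSpace M] [ChartedSpace H' M]
  {f : M → N} {p : M}

lemma normalPart_add (v w : TangentSpace I (f p)) :
    normalPart J f p (v + w) = normalPart J f p v + normalPart J f p w := by
  simp only [normalPart, map_add]; abel

lemma normalPart_smul (c : ℝ) (v : TangentSpace I (f p)) :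
    normalPart J f p (c • v) = c • normalPart J f p v := by
  simp only [normalPart, map_smul, smul_sub]

lemma normalPart_of_mem {v : TangentSpace I (f p)} (hv : v ∈ tangent I J f p) :
    normalPart J f p v = 0 := by
  rw [normalPart, Submodule.starProjection_eq_self_iff.2 hv, sub_self]

lemma normalPart_zero : normalPart J f p (0 : TangentSpace I (f p)) = 0 :=
  normalPart_of_mem (Submodule.zero_mem _)

lemma mfderiv_mem_tangent (v : TangentSpace J p) : mfderiv J I f p v ∈ tangent I J f p :=
  LinearMap.mem_range_self _ v

lemma mfderiv_tangentPart {w : TangentSpace I (f p)} (hw : w ∈ tangent I J f p) :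
    mfderiv J I f p (tangentPart J f p w) = w := by
  rw [tangentPart, Submodule.starProjection_eq_self_iff.2 hw]
  exact Function.invFun_eq hw

variable [IsManifold J ∞ M] [J.Boundaryless]
  (cov : CovariantDerivative I E (fun x : N => TangentSpace I x))

lemma normalPart_covAlong_mfderiv (hf : ContMDiff J I ∞ f) {V : Π q : M, TangentSpace J q}
    (hV : MDiffAt (T% V) p) (u : TangentSpace J p) :
    normalPart J f p (covAlong J cov f (fun q => mfderiv J I f q (V q)) p u) =
      normalPart J f p
        ((trivializationAt E (fun y : N => TangentSpace I y) (f p)).symmL ℝ (f p)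
          (fderiv ℝ (fderiv ℝ (chartRep I J f p)) (extChartAt J p p)
            (coords J p ⟨p, u⟩) (coords J p ⟨p, V p⟩))
        + cov (extend E (mfderiv J I f p (V p))) (f p) (mfderiv J I f p u)) := by
  rw [covAlong_eq, mvfderiv_coords_mfderiv hf hV, map_add]
  -- Every vector of the model space is the coordinate vector of some `w ∈ T_p M`, so `DF(a)`
  -- represents `df(w)`, which has no normal part.
  set a := mvfderiv J (fun q => coords J p ⟨q, V q⟩) p u
  obtain ⟨w, hw⟩ : ∃ w : TangentSpace J p, coords J p ⟨p, w⟩ = a :=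
    ⟨_, coords_symm (mem_chart_source H' p) a⟩
  have ht : (trivializationAt E (fun y : N => TangentSpace I y) (f p)).symmL ℝ (f p)
      (fderiv ℝ (chartRep I J f p) (extChartAt J p p) a) = mfderiv J I f p w := by
    rw [← hw, ← coords_mfderiv hf (mem_chart_source H' p) (mem_chart_source H (f p))
      ((contDiffAt_chartRep hf).differentiableAt (by simp)),
      ← symm_eq_symmL (mem_chart_source H (f p)), symm_coords (mem_chart_source H (f p))]
  rw [ht]
  simp only [normalPart_add]
  rw [normalPart_of_mem (mfderiv_mem_tangent w), add_zero]

variable [FiniteDimensional ℝ E']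

/-- The chart formula for the normal part sees `V` only through `V p`, so any differentiable
extension may replace the one in the definition of `sff`. -/
lemma sff_eq_normalPart_covAlong (hf : ContMDiff J I ∞ f) {V : Π q : M, TangentSpace J q}
    (hV : MDiffAt (T% V) p) (u : TangentSpace J p) :
    sff cov f p u (V p) =
      normalPart J f p (covAlong J cov f (fun q => mfderiv J I f q (V q)) p u) := by
  rw [sff, normalPart_covAlong_mfderiv cov hf hV,
    normalPart_covAlong_mfderiv cov hf (mdifferentiableAt_extend ..), extend_apply_self]

lemma sff_eq (hf : ContMDiff J I ∞ f) (u v : TangentSpace J p) :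
    sff cov f p u v =
      normalPart J f p
        ((trivializationAt E (fun y : N => TangentSpace I y) (f p)).symmL ℝ (f p)
          (fderiv ℝ (fderiv ℝ (chartRep I J f p)) (extChartAt J p p)
            (coords J p ⟨p, u⟩) (coords J p ⟨p, v⟩))
        + cov (extend E (mfderiv J I f p v)) (f p) (mfderiv J I f p u)) := by
  rw [sff, normalPart_covAlong_mfderiv cov hf (mdifferentiableAt_extend ..), extend_apply_self]

lemma sff_add_left (hf : ContMDiff J I ∞ f) (u u' v : TangentSpace J p) :
    sff cov f p (u + u') v = sff cov f p u v + sff cov f p u' v := by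
  simp only [sff_eq cov hf, coords_add (mem_chart_source H' p), map_add,
    add_apply, normalPart_add]
  abel

lemma sff_smul_left (hf : ContMDiff J I ∞ f) (c : ℝ) (u v : TangentSpace J p) :
    sff cov f p (c • u) v = c • sff cov f p u v := by
  simp only [sff_eq cov hf, coords_smul (mem_chart_source H' p), map_smul,
    smul_apply, normalPart_add, normalPart_smul, smul_add]

variable {cov}

/-- Both ingredients of `sff_eq` are symmetric: the Hessian of the chart expression, and the
Christoffel term by vanishing torsion. -/
lemma IsLeviCivita.sff_comm (hcov : IsLeviCivita cov) (hf : ContMDiff J I ∞ f)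
    (u v : TangentSpace J p) : sff cov f p u v = sff cov f p v u := by
  have hsymm : IsSymmSndFDerivAt ℝ (chartRep I J f p) (extChartAt J p p) :=
    (contDiffAt_chartRep hf).isSymmSndFDerivAt (by simp)
  rw [sff_eq cov hf, sff_eq cov hf, hsymm.eq, hcov.cov_extend_comm]

lemma normalCov_zero (hf : ContinuousAt f p) (u : TangentSpace J p) :
    normalCov cov f (fun q => (0 : TangentSpace I (f q))) p u = 0 := by
  rw [normalCov, covAlong_zero cov hf, normalPart_zero]

lemma normalCurvature_zero (hf : Continuous f) (X Y : Π q : M, TangentSpace J q) :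
    normalCurvature cov f X Y (fun q => (0 : TangentSpace I (f q))) p = 0 := by
  simp only [normalCurvature, normalCov_zero hf.continuousAt, sub_self]

/-- `R^⊥` differentiates `σ(U, V)` as a field along `f`, so vanishing is required at every `q`, not
only at `p`. -/
lemma concircularDotSff_eq_of_sff_eq_zero (n : ℕ) (hf : Continuous f)
    {X Y U V : Π q : M, TangentSpace J q} (h : ∀ q, sff cov f q (U q) (V q) = 0) :
    concircularDotSff n cov f X Y U V p =
      - sff cov f p (concircularTangent n cov f X Y U p) (V p)
        - sff cov f p (U p) (concircularTangent n cov f X Y V p) := by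
  simp only [concircularDotSff, h, normalCurvature_zero hf, zero_sub]

end SecondFundamentalForm

/-! ### Immersions: local left inverses and smooth vector fields on the source. -/

section Immersion

variable {E : Type*} [NormedAddCommGroup E] [NormedSpace ℝ E]
  {H : Type*} [TopologicalSpace H] {I : ModelWithCorners ℝ E H}
  {N : Type*} [TopologicalSpace N] [ChartedSpace H N] [IsManifold I ∞ N]
  {E' : Type*} [NormedAddCommGroup E'] [NormedSpace ℝ E']
  {H' : Type*} [TopologicalSpace H'] {J : ModelWithCorners ℝ E' H'}
  {M : Type*} [TopologicalSpace M] [ChartedSpace H' M] [IsManifold J ∞ M]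
  {f : M → N} {p : M}

/-- An immersion has smooth left inverses locally. -/
lemma exists_local_leftInverse [J.Boundaryless] (hf : IsImmersionAt J I ∞ f p) :
    ∃ (U : Set N) (r : N → M), IsOpen U ∧ f p ∈ U ∧ ContMDiffOn I J ∞ r U ∧
      ∀ᶠ q in 𝓝 p, r (f q) = q := by
  let e := hf.domChart
  let e' := hf.codChart
  -- In adapted charts `f` reads `x ↦ (x, 0)`; projecting to the first factor undoes it.
  let g : N → E' := fun y => (hf.equiv.symm (e'.extend I y)).1
  have hg : ContMDiffOn I 𝓘(ℝ, E') ∞ g e'.source :=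
    ((ContinuousLinearMap.fst ℝ E' hf.complement).comp
      (hf.equiv.symm : E →L[ℝ] E' × hf.complement)).contMDiff.comp_contMDiffOn
      (OpenPartialHomeomorph.contMDiffOn_extend hf.codChart_mem_maximalAtlas)
  have hopen : IsOpen (e.extend J).target := e.isOpen_extend_target
  have hgf : ∀ q ∈ e.source, g (f q) = e.extend J q := by
    intro q hq
    have hq' : e.extend J q ∈ (e.extend J).target := (e.extend J).map_source (by simpa using hq)
    have h := hf.writtenInCharts hq'
    have hinv : (e.extend J).symm (e.extend J q) = q := e.extend_left_inv hq
    simp only [Function.comp_apply] at h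
    rw [hinv] at h
    simp only [g]
    rw [h]
    simp
  have hes : ContMDiffOn 𝓘(ℝ, E') J ∞ (e.extend J).symm (e.extend J).target := by
    have h := contMDiffOn_extend_symm hf.domChart_mem_maximalAtlas
    rwa [J.image_eq, ← OpenPartialHomeomorph.extend_target] at h
  refine ⟨e'.source ∩ g ⁻¹' (e.extend J).target, (e.extend J).symm ∘ g,
    hg.continuousOn.isOpen_inter_preimage e'.open_source hopen, ⟨hf.mem_codChart_source, ?_⟩,
    hes.comp (hg.mono Set.inter_subset_left) fun y hy => hy.2, ?_⟩
  · rw [Set.mem_preimage, hgf p hf.mem_domChart_source]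
    exact (e.extend J).map_source (by simpa using hf.mem_domChart_source)
  · filter_upwards [e.open_source.mem_nhds hf.mem_domChart_source] with q hq
    rw [Function.comp_apply, hgf q hq]
    exact e.extend_left_inv hq

lemma mfderiv_leftInverse_apply {r : N → M} (hr : MDifferentiableAt I J r (f p))
    (hf : MDifferentiableAt J I f p) (h : ∀ᶠ q in 𝓝 p, r (f q) = q) (v : TangentSpace J p) :
    (mfderiv I J r (f p) (mfderiv J I f p v) : E') = v := by
  have h1 : HasMFDerivAt J J (r ∘ f) p _ := hr.hasMFDerivAt.comp p hf.hasMFDerivAt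
  have h2 : HasMFDerivAt J J (r ∘ f) p (ContinuousLinearMap.id ℝ (TangentSpace J p)) :=
    (hasMFDerivAt_id p).congr_of_eventuallyEq h
  exact congr($(hasMFDerivAt_unique h1 h2) v)

lemma mfderiv_injective_of_isImmersionAt [J.Boundaryless] (hf : IsImmersionAt J I ∞ f p) :
    Function.Injective (mfderiv J I f p) := by
  obtain ⟨U, r, hU, hp, hr, hrf⟩ := exists_local_leftInverse hf
  have hr' := ((hr _ hp).contMDiffAt (hU.mem_nhds hp)).mdifferentiableAt (by simp)
  have hf' := hf.contMDiffAt.mdifferentiableAt (by simp)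
  intro v w hvw
  have h1 := mfderiv_leftInverse_apply hr' hf' hrf v
  have h2 := mfderiv_leftInverse_apply hr' hf' hrf w
  rw [hvw] at h1
  exact h1.symm.trans h2

/-- A vector field on the source of an immersion is smooth if its image extends smoothly. -/
lemma contMDiff_of_mfderiv_eq [J.Boundaryless] (hf : IsImmersion J I ∞ f)
    {X : Π x : N, TangentSpace I x} (hX : CMDiff ∞ (T% X)) {V : Π q : M, TangentSpace J q}
    (hV : ∀ q, mfderiv J I f q (V q) = X (f q)) : CMDiff ∞ (T% V) := by
  intro p
  obtain ⟨U, r, hU, hp, hr, hrf⟩ := exists_local_leftInverse (hf.isImmersionAt p)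
  have hfs : ContMDiff J I ∞ f := hf.contMDiff
  -- Near `p`, `V = dr ∘ X ∘ f` because `r ∘ f = id`; the right-hand side is a composition of smooth
  -- maps.
  have hT := hr.contMDiffOn_tangentMapWithin (m := ∞) (by simp) hU.uniqueMDiffOn
  have hmem : (⟨f p, X (f p)⟩ : TangentBundle I N) ∈ π E (TangentSpace I) ⁻¹' U := hp
  have hopen : IsOpen (π E (TangentSpace I : N → Type _) ⁻¹' U) :=
    hU.preimage (FiberBundle.continuous_proj E _)
  have hT' := ((hT _ hmem).contMDiffAt (hopen.mem_nhds hmem)).comp p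
    ((hX (f p)).comp p (hfs p))
  refine hT'.congr_of_eventuallyEq ?_
  filter_upwards [hrf.eventually_nhds, (hfs p).continuousAt (hU.mem_nhds hp)] with q hq hqU
  have hr' := ((hr _ hqU).contMDiffAt (hU.mem_nhds hqU)).mdifferentiableAt (by simp)
  have h1 := mfderiv_leftInverse_apply hr' ((hfs q).mdifferentiableAt (by simp)) hq (V q)
  have h2 := tangentMapWithin_eq_tangentMap (p := (⟨f q, X (f q)⟩ : TangentBundle I N))
    (hU.uniqueMDiffOn _ hqU) hr'
  simp only [Function.comp_apply]
  rw [h2, tangentMap, ← hV q]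
  have h0 : r (f q) = q := hq.self_of_nhds
  refine TotalSpace.ext h0.symm (heq_of_eq ?_)
  exact h1.symm

/-- Every tangent vector is the value of a global smooth vector field. -/
lemma exists_contMDiff_vectorField [FiniteDimensional ℝ E'] [T2Space M] (v : TangentSpace J p) :
    ∃ V : Π q : M, TangentSpace J q, CMDiff ∞ (T% V) ∧ V p = v := by
  obtain ⟨s, hs, hsm⟩ := exists_contMDiffOn_extend (k := ∞) J E' v
  obtain ⟨ρ, -, hρ⟩ := (SmoothBumpFunction.nhds_basis_tsupport (I := J) p).mem_iff.1
    (interior_mem_nhds.2 hs)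
  refine ⟨(ρ : M → ℝ) • extend E' v, ?_, ?_⟩
  · exact ContMDiffOn.smul_section_of_tsupport ρ.contMDiff.contMDiffOn isOpen_interior hρ
      (hsm.mono interior_subset)
  · simp

end Immersion

/-! ### Invariant submanifolds and the evaluation of `Q(g, 𝒞·σ)` on `ξ`. -/

section Invariant

variable {E : Type*} [NormedAddCommGroup E] [NormedSpace ℝ E] [FiniteDimensional ℝ E]
  {H : Type*} [TopologicalSpace H] {I : ModelWithCorners ℝ E H}
  {N : Type*} [TopologicalSpace N] [ChartedSpace H N] [IsManifold I ∞ N]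
  [RiemannianBundle (fun x : N => TangentSpace I x)]
  {E' : Type*} [NormedAddCommGroup E'] [NormedSpace ℝ E'] [FiniteDimensional ℝ E']
  {H' : Type*} [TopologicalSpace H'] {J : ModelWithCorners ℝ E' H'} [J.Boundaryless]
  {M : Type*} [TopologicalSpace M] [ChartedSpace H' M] [IsManifold J ∞ M]
  {cov : CovariantDerivative I E (fun x : N => TangentSpace I x)}
  {S : AlmostContactMetric I N} {f₁ f₂ f₃ : N → ℝ} {α β : N → ℝ}
  {f : M → N}

/-- `𝒞(u, v)ξ = (f₁ - f₃ - r / (2n(2n+1))) (η(v)u - η(u)v)`. -/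
lemma IsGeneralizedSasakianSpaceForm.concircular_ξ
    (hN : IsGeneralizedSasakianSpaceForm cov S f₁ f₂ f₃) (n : ℕ) (x : N) (u v : TangentSpace I x) :
    concircular n cov x u v (S.ξ x) =
      (f₁ x - f₃ x - scalarCurvature cov x / (2 * n * (2 * n + 1))) •
        (S.η x v • u - S.η x u • v) := by
  rw [concircular, hN.curvature_eq]
  -- The `f₂` terms vanish because `φξ = 0`; in the `f₃` terms the two multiples of `ξ` cancel, both
  -- having coefficient `η(u)η(v)`.
  simp only [S.φ_ξ, S.η_ξ, ← S.η_eq, inner_zero_right]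
  module

/-- The structure vector field of an invariant submanifold. -/
def tangentξ (S : AlmostContactMetric I N) (J : ModelWithCorners ℝ E' H') (f : M → N) (q : M) :
    TangentSpace J q :=
  tangentPart J f q (S.ξ (f q))

lemma IsInvariant.mfderiv_tangentξ (hinv : IsInvariant S J f) (q : M) :
    mfderiv J I f q (tangentξ S J f q) = S.ξ (f q) :=
  mfderiv_tangentPart (hinv.ξ_mem q)

lemma IsInvariant.contMDiff_tangentξ (hinv : IsInvariant S J f) (hf : IsImmersion J I ∞ f) :
    CMDiff ∞ (T% (tangentξ S J f)) :=
  contMDiff_of_mfderiv_eq hf S.smooth_ξ hinv.mfderiv_tangentξ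

/-- Along `M` the derivative is that of the ambient `ξ` in the direction `df(u)`, a combination of
`φ(df u)`, `df u` and `ξ`, all tangent by invariance. -/
lemma IsInvariant.sff_tangentξ (hinv : IsInvariant S J f) (hf : IsImmersion J I ∞ f)
    (hξ : ∀ (x : N) (u : TangentSpace I x),
      cov S.ξ x u = -(α x • S.φ x u) + β x • (u - S.η x u • S.ξ x))
    (q : M) (u : TangentSpace J q) : sff cov f q u (tangentξ S J f q) = 0 := by
  have hfs : ContMDiff J I ∞ f := hf.contMDiff
  rw [sff_eq_normalPart_covAlong cov hfs
    ((hinv.contMDiff_tangentξ hf q).mdifferentiableAt (by simp))]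
  simp only [hinv.mfderiv_tangentξ]
  rw [covAlong_comp cov ((hfs q).mdifferentiableAt (by simp))
    ((S.smooth_ξ (f q)).mdifferentiableAt (by simp)), hξ]
  refine normalPart_of_mem ?_
  have hu := mfderiv_mem_tangent (I := I) (f := f) u
  exact Submodule.add_mem _ (Submodule.neg_mem _ (Submodule.smul_mem _ _ (hinv.φ_mem q _ hu)))
    (Submodule.smul_mem _ _ (Submodule.sub_mem _ hu (Submodule.smul_mem _ _ (hinv.ξ_mem q))))

/-- The ambient `𝒞(X, ξ)ξ` is already the image of a vector of `M`, so taking the tangential part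
only undoes the injective `df`. -/
lemma IsInvariant.concircularTangent_tangentξ (hinv : IsInvariant S J f)
    (hf : IsImmersion J I ∞ f) (hN : IsGeneralizedSasakianSpaceForm cov S f₁ f₂ f₃) (n : ℕ)
    (X : Π q : M, TangentSpace J q) (q : M) :
    concircularTangent n cov f X (tangentξ S J f) (tangentξ S J f) q =
      (f₁ (f q) - f₃ (f q) - scalarCurvature cov (f q) / (2 * n * (2 * n + 1))) •
        (X q - S.η (f q) (mfderiv J I f q (X q)) • tangentξ S J f q) := by
  apply mfderiv_injective_of_isImmersionAt (hf.isImmersionAt q)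
  have h : concircular n cov (f q) (mfderiv J I f q (X q))
      (mfderiv J I f q (tangentξ S J f q)) (mfderiv J I f q (tangentξ S J f q)) =
      mfderiv J I f q ((f₁ (f q) - f₃ (f q) - scalarCurvature cov (f q) / (2 * n * (2 * n + 1))) •
        (X q - S.η (f q) (mfderiv J I f q (X q)) • tangentξ S J f q)) := by
    rw [map_smul, map_sub, map_smul, hinv.mfderiv_tangentξ, hN.concircular_ξ, S.η_ξ, one_smul]
  rw [concircularTangent, h]
  exact mfderiv_tangentPart (mfderiv_mem_tangent _)

/-- With `σ(·, ξ) = 0`, only `σ(U, 𝒞(X, ξ)ξ)` survives, and the `ξ`-component of `𝒞(X, ξ)ξ`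
contributes nothing to it. -/
lemma IsInvariant.concircularDotSff_tangentξ_right (hinv : IsInvariant S J f)
    (hf : IsImmersion J I ∞ f) (hcov : IsLeviCivita cov)
    (hN : IsGeneralizedSasakianSpaceForm cov S f₁ f₂ f₃)
    (hξ : ∀ (x : N) (u : TangentSpace I x),
      cov S.ξ x u = -(α x • S.φ x u) + β x • (u - S.η x u • S.ξ x)) (n : ℕ)
    (X U : Π q : M, TangentSpace J q) (q : M) :
    concircularDotSff n cov f X (tangentξ S J f) U (tangentξ S J f) q =
      -((f₁ (f q) - f₃ (f q) - scalarCurvature cov (f q) / (2 * n * (2 * n + 1))) •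
        sff cov f q (X q) (U q)) := by
  have hfs : ContMDiff J I ∞ f := hf.contMDiff
  have h0 := hinv.sff_tangentξ (cov := cov) hf hξ
  rw [concircularDotSff_eq_of_sff_eq_zero n hfs.continuous fun q => h0 q (U q), h0,
    hinv.concircularTangent_tangentξ hf hN, hcov.sff_comm hfs (U q), sff_smul_left cov hfs,
    sub_eq_add_neg (X q), ← neg_smul, sff_add_left cov hfs, sff_smul_left cov hfs,
    hcov.sff_comm hfs (tangentξ S J f q), h0]
  simp

lemma IsInvariant.concircularDotSff_tangentξ_left (hinv : IsInvariant S J f)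
    (hf : IsImmersion J I ∞ f) (hcov : IsLeviCivita cov)
    (hN : IsGeneralizedSasakianSpaceForm cov S f₁ f₂ f₃)
    (hξ : ∀ (x : N) (u : TangentSpace I x),
      cov S.ξ x u = -(α x • S.φ x u) + β x • (u - S.η x u • S.ξ x)) (n : ℕ)
    (X U : Π q : M, TangentSpace J q) (q : M) :
    concircularDotSff n cov f X (tangentξ S J f) (tangentξ S J f) U q =
      -((f₁ (f q) - f₃ (f q) - scalarCurvature cov (f q) / (2 * n * (2 * n + 1))) •
        sff cov f q (X q) (U q)) := by
  have hfs : ContMDiff J I ∞ f := hf.contMDiff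
  rw [← hinv.concircularDotSff_tangentξ_right hf hcov hN hξ]
  simp only [concircularDotSff, fun q => hcov.sff_comm hfs (tangentξ S J f q),
    hcov.sff_comm hfs _ (U q)]
  abel

lemma isTotallyGeodesic_iff [T2Space M] (n : ℕ) (hn : 1 ≤ n) (hcov : IsLeviCivita cov)
    (hN : IsGeneralizedSasakianSpaceForm cov S f₁ f₂ f₃)
    (hξ : ∀ (x : N) (u : TangentSpace I x),
      cov S.ξ x u = -(α x • S.φ x u) + β x • (u - S.η x u • S.ξ x))
    (hf : IsImmersion J I ∞ f) (hinv : IsInvariant S J f)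
    (hr : ∀ p : M, scalarCurvature cov (f p) ≠ 2 * n * (2 * n + 1) * (f₁ (f p) - f₃ (f p))) :
    IsTotallyGeodesic cov J f ↔ QgConcircularSffVanishes n cov J f := by
  have hfs : ContMDiff J I ∞ f := hf.contMDiff
  constructor
  · intro h X Y W K U V _ _ _ _ _ _ p
    have h' (A B : Π q : M, TangentSpace J q) : concircularDotSff n cov f X Y A B p = 0 := by
      rw [concircularDotSff_eq_of_sff_eq_zero n hfs.continuous fun q => h q _ _, h, h]
      simp
    simp only [tachibana, h', neg_zero, sub_zero]
  · intro h p u v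
    obtain ⟨X, hX, rfl⟩ := exists_contMDiff_vectorField v
    obtain ⟨U, hU, rfl⟩ := exists_contMDiff_vectorField u
    have hT := hinv.contMDiff_tangentξ hf
    -- This is `hr` divided by `2n(2n+1)`, which is nonzero because `n ≥ 1`.
    have hc : f₁ (f p) - f₃ (f p) - scalarCurvature cov (f p) / (2 * n * (2 * n + 1)) ≠ 0 := by
      have hn' : (2 * n * (2 * n + 1) : ℝ) ≠ 0 := by positivity
      intro h0
      apply hr p
      field_simp at h0
      linarith
    -- The choice is `Y = W = K = V = ξ`: then `ξ` sits in one slot of each `𝒞(X, ξ)·σ` term, and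
    -- both terms equal `c σ(X, (U ∧ ξ)ξ)` after signs, adding up instead of cancelling.
    have hQ := h X _ _ _ U _ hX hT hT hT hU hT p
    rw [tachibana, hinv.concircularDotSff_tangentξ_right hf hcov hN hξ,
      hinv.concircularDotSff_tangentξ_left hf hcov hN hξ] at hQ
    have hw : wedge (inducedMetric I f) U (tangentξ S J f) (tangentξ S J f) p =
        U p + (-inducedMetric I f U (tangentξ S J f) p) • tangentξ S J f p := by
      have h1 : inducedMetric I f (tangentξ S J f) (tangentξ S J f) p = 1 := by
        rw [inducedMetric, hinv.mfderiv_tangentξ, ← S.η_eq, S.η_ξ]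
      rw [wedge, h1, one_smul, neg_smul, sub_eq_add_neg]
    -- The `ξ`-part of `(U ∧ ξ)ξ` is annihilated by `σ`, leaving `2c σ(U, X) = 0`.
    rw [hw, hcov.sff_comm hfs, sff_add_left cov hfs, sff_smul_left cov hfs,
      hcov.sff_comm hfs (tangentξ S J f p), hinv.sff_tangentξ hf hξ, smul_zero, add_zero,
      neg_neg, sub_neg_eq_add, ← two_smul ℝ] at hQ
    simpa [hc] using hQ

end Invariant
end
end GSSF

theorem theorem3p6 (n m : ℕ) (hn : 1 ≤ n)
    {N : Type*} [TopologicalSpace N] [T2Space N]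
    [ChartedSpace (EuclideanSpace ℝ (Fin (2 * n + 1))) N] [IsManifold (𝓡 (2 * n + 1)) ∞ N]
    [RiemannianBundle (fun x : N => TangentSpace (𝓡 (2 * n + 1)) x)]
    [IsContMDiffRiemannianBundle (𝓡 (2 * n + 1)) ∞ (EuclideanSpace ℝ (Fin (2 * n + 1)))
      (fun x : N => TangentSpace (𝓡 (2 * n + 1)) x)]
    {M : Type*} [TopologicalSpace M] [T2Space M]
    [ChartedSpace (EuclideanSpace ℝ (Fin m)) M] [IsManifold (𝓡 m) ∞ M]
    (cov : CovariantDerivative (𝓡 (2 * n + 1)) (EuclideanSpace ℝ (Fin (2 * n + 1)))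
      (fun x : N => TangentSpace (𝓡 (2 * n + 1)) x))
    (hcov : GSSF.IsLeviCivita cov)
    (S : GSSF.AlmostContactMetric (𝓡 (2 * n + 1)) N) (f₁ f₂ f₃ : N → ℝ)
    (hN : GSSF.IsGeneralizedSasakianSpaceForm cov S f₁ f₂ f₃)
    (α β : N → ℝ)
    (hξ : ∀ (x : N) (u : TangentSpace (𝓡 (2 * n + 1)) x),
      cov S.ξ x u = -(α x • S.φ x u) + β x • (u - S.η x u • S.ξ x))
    (f : M → N) (hf : Manifold.IsImmersion (𝓡 m) (𝓡 (2 * n + 1)) ∞ f)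
    (hinv : GSSF.IsInvariant S (𝓡 m) f)
    (hr : ∀ p : M, GSSF.scalarCurvature cov (f p) ≠
      2 * n * (2 * n + 1) * (f₁ (f p) - f₃ (f p))) :
    GSSF.IsTotallyGeodesic cov (𝓡 m) f ↔ GSSF.QgConcircularSffVanishes n cov (𝓡 m) f :=
  GSSF.isTotallyGeodesic_iff n hn hcov hN hξ hf hinv hr
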